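/- Let $M_n\{0,1\}$ be the set of $n\times n$ matrices with all entries in $\{0,1\}$. For $A\in M_n\{0,1\}$, the stable index $\theta(A)$ is $\infty$ if $A^k\in M_n\{0,1\}$ for every positive integer $k$ (ordinary integer matrix powers); otherwise $\theta(A)$ is the smallest positive integer $k$ such that $A^{k+1}\notin M_n\{0,1\}$. Let $D(A)$ be the digraph with vertex set $\{1,\dots,n\}$ and an arc (possibly a loop) from $i$ to $j$ if and only if the $(i,j)$ entry of $A$ is $1$. For positive integers $p,q$ and an integer $k\ge 2$, let $\overrightarrow{g}(p,k,q)$ be the digraph, unique up to isomorphism, obtained from two disjoint directed cycles with $p$ and $q$ vertices (a directed cycle with one vertex is a loop) by adding a directed path with $k-1$ arcs, and hence $k-2$ new interior vertices, from a vertex of the $p$-cycle to a vertex of the $q$-cycle; write $\overrightarrow{g}(p,q)=\overrightarrow{g}(p,2,q)$. For a positive integer $n$ put $$g(n)=\begin{cases}\frac{n^2-1}{4},&\text{if } n \text{ is odd},\\ \frac{n^2-4}{4},&\text{if } n\equiv 0\pmod 4,\\ \frac{n^2-16}{4},&\text{if } n\equiv 2\pmod 4.\end{cases}$$ Theorem.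 Let $n\ge 7$ be an integer and let $A\in M_n\{0,1\}$ with $\theta(A)<\infty$. Then $\theta(A)\le g(n)$, with equality if and only if one of the following holds: (1) $n\ne 10$ and $D(A)\cong\overrightarrow{g}(p,q)$ for some $p,q$ with $$\{p,q\}=\begin{cases}\left\{\frac{n+1}{2},\frac{n-1}{2}\right\},&\text{if } n \text{ is odd},\\ \left\{\frac{n+2}{2},\frac{n-2}{2}\right\},&\text{if } n\equiv 0\pmod 4,\\ \left\{\frac{n+4}{2},\frac{n-4}{2}\right\},&\text{if } n\equiv 2\pmod 4;\end{cases}$$ (2) $n=10$ and $D(A)$ is isomorphic to one of $\overrightarrow{g}(3,7)$, $\overrightarrow{g}(7,3)$, $\overrightarrow{g}(4,3,5)$, $\overrightarrow{g}(5,3,4)$. -/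

import Mathlib

/-- `A` is a 0-1 matrix: every entry is `0` or `1`. (Entries are natural numbers, so that the
powers of `A` are the ordinary, integer-valued matrix powers.) -/
def IsZeroOne {n : ℕ} (A : Matrix (Fin n) (Fin n) ℕ) : Prop :=
  ∀ i j, A i j = 0 ∨ A i j = 1

open Classical in
/-- The stable index `θ(A)` of a 0-1 matrix `A`: it is `∞` if `A ^ k` is a 0-1 matrix for every
positive integer `k`, and otherwise the smallest positive integer `k` such that `A ^ (k + 1)` is
not a 0-1 matrix. -/
noncomputable def stableIndex {n : ℕ} (A : Matrix (Fin n) (Fin n) ℕ) : ℕ∞ :=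
  if ∀ k : ℕ, 0 < k → IsZeroOne (A ^ k) then ⊤
  else ((sInf {k : ℕ | 0 < k ∧ ¬ IsZeroOne (A ^ (k + 1))} : ℕ) : ℕ∞)

/-- The digraph `D(A)` of a 0-1 matrix: there is an arc (possibly a loop) from `i` to `j` iff
the `(i, j)` entry is `1`. -/
def matrixDigraph {n : ℕ} (A : Matrix (Fin n) (Fin n) ℕ) : Digraph (Fin n) where
  Adj i j := A i j = 1

/-- Isomorphism of digraphs: a bijection of the vertex sets that preserves and reflects arcs. -/
def DigraphIso {V W : Type*} (D : Digraph V) (H : Digraph W) : Prop :=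
  Nonempty (D.Adj ≃r H.Adj)

/-- For `2 ≤ k`: the disjoint union of directed cycles of lengths `p` and `q`, joined by a directed
path with `k - 1` arcs (hence `k - 2` new interior vertices) from the vertex `a` of the `p`-cycle
to the vertex `b` of the `q`-cycle. The three summands of the vertex type are the `p`-cycle, the
interior vertices of the path in order, and the `q`-cycle. A cycle of length `1` is a loop. -/
def glassesAt (p k q : ℕ) (a : Fin p) (b : Fin q) :
    Digraph (Fin p ⊕ Fin (k - 2) ⊕ Fin q) where
  Adj
    | .inl i, .inl j => j.val = (i.val + 1) % p
    | .inl i, .inr (.inl s) => i = a ∧ s.val = 0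
    | .inl i, .inr (.inr j) => k = 2 ∧ i = a ∧ j = b
    | .inr (.inl s), .inr (.inl t) => t.val = s.val + 1
    | .inr (.inl s), .inr (.inr j) => s.val + 1 = k - 2 ∧ j = b
    | .inr (.inr i), .inr (.inr j) => j.val = (i.val + 1) % q
    | .inr (.inl _), .inl _ => False
    | .inr (.inr _), .inl _ => False
    | .inr (.inr _), .inr (.inl _) => False

/-- `D` is (isomorphic to) the digraph `g(p, k, q)`, for `2 ≤ k`: two disjoint directed cycles of
lengths `p` and `q`, and a path with `k - 1` arcs from some vertex of the `p`-cycle to some vertex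
of the `q`-cycle. The case `k = 2` is the glasses digraph `g(p, q)`. -/
def IsGlasses {V : Type*} (D : Digraph V) (p k q : ℕ) : Prop :=
  ∃ (a : Fin p) (b : Fin q), DigraphIso D (glassesAt p k q a b)

/-- The extremal value `g(n)`. For `4 ≤ n` the subtractions do not truncate, and the divisions
by `4` are exact. -/
def gBound (n : ℕ) : ℕ :=
  if n % 2 = 1 then (n ^ 2 - 1) / 4
  else if n % 4 = 0 then (n ^ 2 - 4) / 4
  else (n ^ 2 - 16) / 4

/-- The unordered pair of cycle lengths of the extremal glasses digraphs. For `4 ≤ n` the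
subtractions do not truncate, and the divisions by `2` are exact. -/
def extremalPair (n : ℕ) : Set ℕ :=
  if n % 2 = 1 then {(n + 1) / 2, (n - 1) / 2}
  else if n % 4 = 0 then {(n + 2) / 2, (n - 2) / 2}
  else {(n + 4) / 2, (n - 4) / 2}

/-! A power of `A` fails to be 0-1 through two walks of equal length with the same ends; cutting
their common beginning makes them differ in the first step. So a finite `θ(A)` is the least `t` for
which `HasDiamond` holds (`exists_stableIndex_eq`), and the theorem becomes a statement about
digraphs.

Since `n < g(n)`, only digraphs all of whose diamonds have parameter above `n` matter. There two
closed walks cannot branch at a vertex, so the vertices on closed walks form disjoint cycles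
(`exists_isCycleSucc`). If a `p`-cycle leads to a different `q`-cycle by a shortest path of length
`l`, then `p + q + l ≤ n + 1`, and turning around the first cycle before the path or around the
second one after it gives a diamond with parameter `lcm(p,q) + l - 1`. Hence `t ≤ lcm(p,q) + n - p -
q`, and `lcm_bound` maximizes the right side. If no cycle leads to another, `exists_lt_lcm` shortens
a minimal diamond until it is strictly below the bound.

In the case of equality the lengths are coprime, and the two cycles and the path use all vertices.
By the Chinese remainder theorem a further arc would create a shorter diamond
(`IsBridge.eq_of_hasWalk`), so the digraph is a glasses digraph. Conversely, two walks that leave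
the first cycle of such a digraph at times differing by `r` can meet only if `p` and `q` both divide
`r` (`le_of_hasDiamond_glassesAt`). -/

/-- There is a walk of length `k` from `u` to `v`. -/
def HasWalk {V : Type*} (R : V → V → Prop) : ℕ → V → V → Prop
  | 0, u, v => u = v
  | k + 1, u, v => ∃ x, R u x ∧ HasWalk R k x v

/-- There are two walks of length `k + 1` with the same ends that differ in their first step. -/
def HasDiamond {V : Type*} (R : V → V → Prop) (k : ℕ) : Prop :=
  ∃ u x y v, x ≠ y ∧ R u x ∧ R u y ∧ HasWalk R k x v ∧ HasWalk R k y v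

/-! ### Walks, diamonds and shortest paths -/

section Walks

variable {V : Type*} {R : V → V → Prop}

theorem HasWalk.trans {a b : ℕ} {u v w : V} (h₁ : HasWalk R a u v) (h₂ : HasWalk R b v w) :
    HasWalk R (a + b) u w := by
  induction a generalizing u with
  | zero => cases h₁; simpa using h₂
  | succ a ih =>
    obtain ⟨x, hx, h⟩ := h₁
    rw [Nat.succ_add]
    exact ⟨x, hx, ih h⟩

theorem hasWalk_one {u v : V} (h : R u v) : HasWalk R 1 u v := ⟨v, h, rfl⟩

theorem HasWalk.of_eq {a b : ℕ} {u v : V} (h : HasWalk R a u v) (hab : a = b) : HasWalk R b u v :=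
  hab ▸ h

theorem hasWalk_of_seq {w : ℕ → V} {k : ℕ} (hw : ∀ i < k, R (w i) (w (i + 1))) {i j : ℕ}
    (hij : i ≤ j) (hj : j ≤ k) : HasWalk R (j - i) (w i) (w j) := by
  obtain ⟨d, rfl⟩ := Nat.exists_eq_add_of_le hij
  rw [Nat.add_sub_cancel_left]
  induction d generalizing i with
  | zero => rfl
  | succ d ih =>
    refine ⟨w (i + 1), hw i (by omega), ?_⟩
    have := ih (i := i + 1) (by omega) (by omega)
    rwa [show i + 1 + d = i + (d + 1) by omega] at this

theorem HasWalk.exists_seq {k : ℕ} {u v : V} (h : HasWalk R k u v) :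
    ∃ w : ℕ → V, w 0 = u ∧ w k = v ∧ ∀ i < k, R (w i) (w (i + 1)) := by
  induction k generalizing u with
  | zero => exact ⟨fun _ => u, rfl, h, by simp⟩
  | succ k ih =>
    obtain ⟨x, hx, h⟩ := h
    obtain ⟨w, h0, hk, hw⟩ := ih h
    refine ⟨fun i => Nat.casesOn i u w, rfl, hk, ?_⟩
    rintro (_ | i) hi
    · simpa [h0] using hx
    · exact hw i (by omega)

theorem not_hasDiamond_zero : ¬ HasDiamond R 0 := by
  rintro ⟨u, x, y, v, hxy, -, -, h₁, h₂⟩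
  exact hxy (Eq.trans h₁ (Eq.symm h₂))

theorem HasWalk.map {W : Type*} {H : W → W → Prop} (f : R ≃r H) {k : ℕ} {u v : V}
    (h : HasWalk R k u v) : HasWalk H k (f u) (f v) := by
  induction k generalizing u with
  | zero => exact congrArg f h
  | succ k ih =>
    obtain ⟨x, hx, h⟩ := h
    exact ⟨f x, f.map_rel_iff.2 hx, ih h⟩

theorem HasDiamond.map {W : Type*} {H : W → W → Prop} (f : R ≃r H) {k : ℕ}
    (h : HasDiamond R k) : HasDiamond H k := by
  obtain ⟨u, x, y, v, hxy, hx, hy, h₁, h₂⟩ := h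
  exact ⟨f u, f x, f y, f v, f.injective.ne hxy, f.map_rel_iff.2 hx, f.map_rel_iff.2 hy,
    h₁.map f, h₂.map f⟩

/-- A shortest walk between two sets repeats no vertex, and meets the sets only at its ends. -/
theorem exists_geodesic {S T : Set V} (h : ∃ k, ∃ s ∈ S, ∃ t ∈ T, HasWalk R k s t) :
    ∃ (k : ℕ) (w : ℕ → V), w 0 ∈ S ∧ w k ∈ T ∧ (∀ i < k, R (w i) (w (i + 1))) ∧
      (∀ i ≤ k, ∀ j ≤ k, w i = w j → i = j) ∧ (∀ i ≤ k, 0 < i → w i ∉ S) ∧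
      ∀ i < k, w i ∉ T := by
  classical
  obtain ⟨s, hs, t, ht, hst⟩ := Nat.find_spec h
  have hmin : ∀ m < Nat.find h, ∀ s ∈ S, ∀ t ∈ T, ¬ HasWalk R m s t := fun m hm s hs t ht hw =>
    Nat.find_min h hm ⟨s, hs, t, ht, hw⟩
  obtain ⟨w, rfl, rfl, hw⟩ := hst.exists_seq
  generalize Nat.find h = k at *
  have key : ∀ i j, i < j → j ≤ k → w i ≠ w j := by
    intro i j hij hj he
    refine hmin (i + (k - j)) (by omega) _ hs _ ht ?_
    exact HasWalk.trans (v := w i) (hasWalk_of_seq hw (Nat.zero_le i) (by omega))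
      (he ▸ hasWalk_of_seq hw hj le_rfl)
  refine ⟨k, w, hs, ht, hw, ?_, ?_, ?_⟩
  · intro i hi j hj he
    rcases lt_trichotomy i j with h | h | h
    · exact absurd he (key i j h hj)
    · exact h
    · exact absurd he.symm (key j i h hi)
  · exact fun i hi h0 hS => hmin (k - i) (by omega) _ hS _ ht (hasWalk_of_seq hw hi le_rfl)
  · exact fun i hi hT => hmin i hi _ hs _ hT (hasWalk_of_seq hw (Nat.zero_le i) hi.le)

end Walks

/-! ### From matrix powers to diamonds -/

section MatrixPowers

variable {n : ℕ} {A : Matrix (Fin n) (Fin n) ℕ}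

theorem pow_apply_pos_iff (hA : IsZeroOne A) (k : ℕ) (i j : Fin n) :
    0 < (A ^ k) i j ↔ HasWalk (matrixDigraph A).Adj k i j := by
  induction k generalizing i with
  | zero =>
    rw [pow_zero, Matrix.one_apply]
    by_cases h : i = j <;> simp [h, HasWalk]
  | succ k ih =>
    rw [pow_succ', Matrix.mul_apply, Finset.sum_pos_iff]
    simp only [Finset.mem_univ, true_and, HasWalk]
    refine exists_congr fun x => ?_
    rw [← ih, CanonicallyOrderedAdd.mul_pos]
    refine and_congr_left fun _ => ?_
    rcases hA i x with h | h <;> simp [matrixDigraph, h]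

theorem HasDiamond.not_isZeroOne (hA : IsZeroOne A) {k : ℕ}
    (h : HasDiamond (matrixDigraph A).Adj k) : ¬ IsZeroOne (A ^ (k + 1)) := by
  obtain ⟨u, x, y, v, hxy, hx, hy, h₁, h₂⟩ := h
  rw [← pow_apply_pos_iff hA] at h₁ h₂
  have hx : A u x = 1 := hx
  have hy : A u y = 1 := hy
  have hle : ∑ z ∈ {x, y}, A u z * (A ^ k) z v ≤ (A ^ (k + 1)) u v := by
    rw [pow_succ', Matrix.mul_apply]
    exact Finset.sum_le_sum_of_subset (Finset.subset_univ _)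
  rw [Finset.sum_pair hxy, hx, hy] at hle
  intro h
  rcases h u v with h | h <;> omega

/-- At the first failing power, an entry of at least 2 is a sum of products that are each 0 or 1, so
two different first steps contribute to it. -/
theorem exists_hasDiamond_of_not_isZeroOne (hA : IsZeroOne A) {k : ℕ}
    (h : ¬ IsZeroOne (A ^ k)) : ∃ m < k, HasDiamond (matrixDigraph A).Adj m := by
  induction k with
  | zero =>
    refine absurd (fun i j => ?_) h
    rw [pow_zero, Matrix.one_apply]
    split <;> simp
  | succ k ih =>
    by_cases hk : IsZeroOne (A ^ k)
    · refine ⟨k, k.lt_succ_self, ?_⟩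
      unfold IsZeroOne at h
      push Not at h
      obtain ⟨u, v, h0, h1⟩ := h
      rw [pow_succ', Matrix.mul_apply] at h0 h1
      obtain ⟨x, -, hx⟩ := Finset.exists_ne_zero_of_sum_ne_zero h0
      have hx1 : A u x = 1 ∧ (A ^ k) x v = 1 := by
        rcases hA u x with a | a <;> rcases hk x v with b | b <;> simp_all
      rw [← Finset.add_sum_erase _ _ (Finset.mem_univ x), hx1.1, hx1.2] at h1
      obtain ⟨y, hy, hy'⟩ := Finset.exists_ne_zero_of_sum_ne_zero
        (s := Finset.univ.erase x) (f := fun z => A u z * (A ^ k) z v) (by omega)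
      have hy1 : A u y = 1 ∧ (A ^ k) y v = 1 := by
        rcases hA u y with a | a <;> rcases hk y v with b | b <;> simp_all
      refine ⟨u, x, y, v, (Finset.ne_of_mem_erase hy).symm, hx1.1, hy1.1, ?_, ?_⟩
      · rw [← pow_apply_pos_iff hA, hx1.2]; exact one_pos
      · rw [← pow_apply_pos_iff hA, hy1.2]; exact one_pos
    · obtain ⟨m, hm, h⟩ := ih hk
      exact ⟨m, by omega, h⟩

/-- A finite stable index is the least length parameter of a diamond. -/
theorem exists_stableIndex_eq (hA : IsZeroOne A) (hfin : stableIndex A < ⊤) :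
    ∃ t : ℕ, stableIndex A = t ∧ HasDiamond (matrixDigraph A).Adj t ∧
      ∀ m < t, ¬ HasDiamond (matrixDigraph A).Adj m := by
  unfold stableIndex at hfin ⊢
  split_ifs at hfin ⊢ with h
  · exact absurd hfin (lt_irrefl _)
  push Not at h
  obtain ⟨k, -, hk⟩ := h
  have mem : ∀ m, HasDiamond (matrixDigraph A).Adj m →
      m ∈ {k : ℕ | 0 < k ∧ ¬ IsZeroOne (A ^ (k + 1))} := fun m hm =>
    ⟨Nat.pos_of_ne_zero fun h => not_hasDiamond_zero (h ▸ hm), hm.not_isZeroOne hA⟩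
  obtain ⟨m, -, hm⟩ := exists_hasDiamond_of_not_isZeroOne hA hk
  obtain ⟨-, hs⟩ := Nat.sInf_mem ⟨m, mem m hm⟩
  refine ⟨_, rfl, ?_, fun m hm h => Nat.notMem_of_lt_sInf hm (mem m h)⟩
  obtain ⟨j, hj, hd⟩ := exists_hasDiamond_of_not_isZeroOne hA hs
  have := Nat.sInf_le (mem j hd)
  rwa [show j = _ from le_antisymm (by omega) this] at hd

end MatrixPowers

/-! ### Diamonds in glasses digraphs -/

section Glasses

variable {p k q : ℕ} {a : Fin p} {b : Fin q}

/-- The vertex of the glasses digraph that a walk of length `x ≥ 1` from `a` reaches if its first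
step leaves the first cycle. -/
def glassesExit (p k q : ℕ) (b : Fin q) (x : ℕ) : Fin p ⊕ Fin (k - 2) ⊕ Fin q :=
  if h : x - 1 < k - 2 then .inr (.inl ⟨x - 1, h⟩)
  else .inr (.inr ⟨(b + (x - (k - 1))) % q, Nat.mod_lt _ b.pos⟩)

/-- The vertex of the first cycle that is `x` steps after `a`. -/
def glassesOrbit (k q : ℕ) (a : Fin p) (x : ℕ) : Fin p ⊕ Fin (k - 2) ⊕ Fin q :=
  .inl ⟨(a + x) % p, Nat.mod_lt _ a.pos⟩

theorem glassesExit_step (hk : 2 ≤ k) {x : ℕ} (hx : 1 ≤ x) {z : Fin p ⊕ Fin (k - 2) ⊕ Fin q}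
    (h : (glassesAt p k q a b).Adj (glassesExit p k q b x) z) :
    z = glassesExit p k q b (x + 1) := by
  have hb := b.2
  unfold glassesExit at h ⊢
  by_cases h1 : x - 1 < k - 2
  · rw [dif_pos h1] at h
    rcases z with i | s | j
    · exact h.elim
    · have h : s.val = x - 1 + 1 := h
      have := s.2
      rw [dif_pos (by omega)]
      congr 2
      ext
      simp only
      omega
    · have h : x - 1 + 1 = k - 2 ∧ j = b := h
      rw [dif_neg (by omega), h.2]
      congr 2
      ext
      simp only
      rw [show x + 1 - (k - 1) = 0 by omega, add_zero, Nat.mod_eq_of_lt hb]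
  · rw [dif_neg h1] at h
    rcases z with i | s | j
    · exact h.elim
    · exact h.elim
    · have h : j.val = ((b + (x - (k - 1))) % q + 1) % q := h
      rw [dif_neg (by omega)]
      congr 2
      ext
      simp only
      rw [h, show x + 1 - (k - 1) = x - (k - 1) + 1 by omega, Nat.mod_add_mod, add_assoc]

theorem HasWalk.eq_glassesExit (hk : 2 ≤ k) {m x : ℕ} (hx : 1 ≤ x)
    {z : Fin p ⊕ Fin (k - 2) ⊕ Fin q}
    (h : HasWalk (glassesAt p k q a b).Adj m (glassesExit p k q b x) z) :
    z = glassesExit p k q b (x + m) := by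
  induction m generalizing x with
  | zero => exact Eq.symm h
  | succ m ih =>
    obtain ⟨y, hy, h⟩ := h
    rw [glassesExit_step hk hx hy] at h
    rw [ih (by omega) h]
    congr 1
    omega

/-- The only branching of a glasses digraph is at `a`, which the orbit visits exactly at multiples
of `p`. -/
theorem glassesOrbit_step {x : ℕ} {z : Fin p ⊕ Fin (k - 2) ⊕ Fin q}
    (h : (glassesAt p k q a b).Adj (glassesOrbit k q a x) z) :
    z = glassesOrbit k q a (x + 1) ∨ p ∣ x ∧ z = glassesExit p k q b 1 := by
  have ha := a.2
  have hdvd : (⟨(a + x) % p, Nat.mod_lt _ a.pos⟩ : Fin p) = a → p ∣ x := by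
    intro h
    have h : (a + x) % p = (a + 0) % p := by
      rw [add_zero, Nat.mod_eq_of_lt ha]; exact congrArg Fin.val h
    exact (Nat.modEq_zero_iff_dvd).1 (Nat.ModEq.add_left_cancel' _ h)
  unfold glassesExit
  rcases z with i | s | j
  · left
    have h : i.val = ((a + x) % p + 1) % p := h
    unfold glassesOrbit
    congr 1
    ext
    simp only
    rw [h, Nat.mod_add_mod, add_assoc]
  · right
    have h : (⟨(a + x) % p, Nat.mod_lt _ a.pos⟩ : Fin p) = a ∧ s.val = 0 := h
    refine ⟨hdvd h.1, ?_⟩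
    have := s.2
    rw [dif_pos (by omega)]
    congr 2
    ext
    exact h.2
  · right
    have h : k = 2 ∧ (⟨(a + x) % p, Nat.mod_lt _ a.pos⟩ : Fin p) = a ∧ j = b := h
    refine ⟨hdvd h.2.1, ?_⟩
    rw [dif_neg (by omega), h.2.2]
    congr 2
    ext
    simp only
    rw [show 1 - (k - 1) = 0 by omega, add_zero, Nat.mod_eq_of_lt b.2]

theorem HasWalk.eq_glassesOrbit_or (hk : 2 ≤ k) {m x : ℕ} {z : Fin p ⊕ Fin (k - 2) ⊕ Fin q}
    (h : HasWalk (glassesAt p k q a b).Adj m (glassesOrbit k q a x) z) :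
    z = glassesOrbit k q a (x + m) ∨
      ∃ r, x ≤ r ∧ r < x + m ∧ p ∣ r ∧ z = glassesExit p k q b (x + m - r) := by
  induction m generalizing x with
  | zero => exact Or.inl (Eq.symm h)
  | succ m ih =>
    obtain ⟨y, hy, h⟩ := h
    rcases glassesOrbit_step hy with rfl | ⟨hd, rfl⟩
    · rcases ih h with h | ⟨r, h1, h2, h3, h4⟩
      · left; rw [h]; congr 1; omega
      · refine Or.inr ⟨r, by omega, by omega, h3, ?_⟩
        rw [h4]; congr 1; omega
    · refine Or.inr ⟨x, le_rfl, by omega, hd, ?_⟩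
      rw [h.eq_glassesExit hk le_rfl]; congr 1; omega

/-- Path vertices are passed only once, so a repetition happens on the second cycle, which is
entered at time `k - 1`. -/
theorem glassesExit_eq (hk : 2 ≤ k) {x y : ℕ} (hx : 1 ≤ x) (hxy : x < y)
    (h : glassesExit p k q b x = glassesExit p k q b y) : k - 1 ≤ x ∧ q ∣ y - x := by
  unfold glassesExit at h
  split_ifs at h with h1 h2 h2
  · have := congrArg Fin.val (Sum.inl_injective (Sum.inr_injective h))
    simp only at this
    omega
  · simp at h
  · simp at h
  · refine ⟨by omega, ?_⟩
    have := congrArg Fin.val (Sum.inr_injective (Sum.inr_injective h))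
    have := Nat.ModEq.add_left_cancel' _ this
    rw [Nat.modEq_iff_dvd' (by omega)] at this
    rwa [show y - (k - 1) - (x - (k - 1)) = y - x by omega] at this

/-- Diamonds in a glasses digraph with coprime cycle lengths are long. -/
theorem le_of_hasDiamond_glassesAt (hk : 2 ≤ k) (hpq : p.Coprime q) {t : ℕ}
    (h : HasDiamond (glassesAt p k q a b).Adj t) : p * q + k - 2 ≤ t := by
  have main : ∀ v, HasWalk (glassesAt p k q a b).Adj t (glassesOrbit k q a 1) v →
      HasWalk (glassesAt p k q a b).Adj t (glassesExit p k q b 1) v → p * q + k - 2 ≤ t := by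
    intro v h₁ h₂
    have hv := h₂.eq_glassesExit hk le_rfl
    rcases h₁.eq_glassesOrbit_or hk with h | ⟨r, h1, h2, h3, h4⟩
    · rw [h] at hv
      unfold glassesOrbit glassesExit at hv
      split_ifs at hv
    · rw [hv] at h4
      -- One walk leaves the first cycle `r` steps after the other. Meeting at time `t + 1` gives `q
      -- ∣ r` besides `p ∣ r`, and the later walk must have reached the second cycle: `k - 1 ≤ t + 1
      -- - r`.
      obtain ⟨h5, h6⟩ := glassesExit_eq hk (by omega) (by omega) h4.symm
      rw [show 1 + t - (1 + t - r) = r by omega] at h6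
      have := Nat.le_of_dvd h1 (hpq.mul_dvd_of_dvd_of_dvd h3 h6)
      omega
  obtain ⟨u, x, y, v, hxy, hx, hy, h₁, h₂⟩ := h
  have hu : (∃ m, u = glassesExit p k q b m ∧ 1 ≤ m) ∨ ∃ m, u = glassesOrbit k q a m := by
    rcases u with i | s | j
    · right
      refine ⟨p - a + i, ?_⟩
      unfold glassesOrbit
      congr 1
      ext
      simp only
      rw [show (a : ℕ) + (p - a + i) = i + p by omega, Nat.add_mod_right, Nat.mod_eq_of_lt i.2]
    · left
      refine ⟨s + 1, ?_, by omega⟩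
      unfold glassesExit
      rw [dif_pos (by simp)]
      rfl
    · left
      refine ⟨k - 1 + (q - b + j), ?_, by omega⟩
      unfold glassesExit
      rw [dif_neg (by omega)]
      congr 2
      ext
      simp only
      rw [show (b : ℕ) + (k - 1 + (q - b + j) - (k - 1)) = j + q by omega, Nat.add_mod_right,
        Nat.mod_eq_of_lt j.2]
  rcases hu with ⟨m, rfl, hm⟩ | ⟨m, rfl⟩
  · exact absurd ((glassesExit_step hk hm hx).trans (glassesExit_step hk hm hy).symm) hxy
  · have orb : p ∣ m → glassesOrbit k q a (m + 1) = glassesOrbit k q a 1 := by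
      rintro ⟨c, rfl⟩
      unfold glassesOrbit
      congr 2
      rw [show (a : ℕ) + (p * c + 1) = a + 1 + p * c by ring, Nat.add_mul_mod_self_left]
    rcases glassesOrbit_step hx with rfl | ⟨hd, rfl⟩ <;>
      rcases glassesOrbit_step hy with rfl | ⟨hd', rfl⟩
    · exact absurd rfl hxy
    · exact main v (orb hd' ▸ h₁) h₂
    · exact main v (orb hd ▸ h₂) h₁
    · exact absurd rfl hxy

end Glasses

/-! ### Disjointness of cycles, and the case where no cycle leads to another -/

open Function

section Cycles

variable {V : Type*} {R : V → V → Prop}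

/-- `u` lies on a closed walk of positive length. -/
def OnClosedWalk (R : V → V → Prop) (u : V) : Prop := ∃ k, HasWalk R (k + 1) u u

/-- Every vertex `u` on a closed walk has a unique out-neighbour from which `u` can be reached,
namely `σ u`. -/
structure IsCycleSucc (R : V → V → Prop) (σ : V → V) : Prop where
  step : ∀ {u}, OnClosedWalk R u → R u (σ u)
  back : ∀ {u}, OnClosedWalk R u → ∃ k, HasWalk R k (σ u) u
  unique : ∀ {u x k}, R u x → HasWalk R k x u → x = σ u

/-- Two different returning steps from `u` would give two closed walks through `u`. Traversing them
in either order yields a diamond, and choosing them shortest keeps its parameter within the number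
of vertices. -/
theorem exists_isCycleSucc [Fintype V] (hmin : ∀ m, HasDiamond R m → Fintype.card V < m) :
    ∃ σ, IsCycleSucc R σ := by
  classical
  have key : ∀ u x y, R u x → R u y → (∃ k, HasWalk R k x u) → (∃ k, HasWalk R k y u) →
      x = y := by
    intro u x y hx hy ⟨k, hk⟩ ⟨l, hl⟩
    by_contra hxy
    obtain ⟨d, w, h0, hd, hw, hinj, -, -⟩ :=
      exists_geodesic (S := {x}) (T := {u}) ⟨k, x, rfl, u, rfl, hk⟩
    obtain rfl : w 0 = x := h0
    obtain rfl : w d = u := hd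
    obtain ⟨f, z, h0, ⟨i, hi, hzf⟩, hz, hzinj, -, hzC⟩ :=
      exists_geodesic (S := {y}) (T := {v | ∃ i ≤ d, w i = v}) ⟨l, y, rfl, w d, ⟨d, le_rfl, rfl⟩, hl⟩
    obtain rfl : z 0 = y := h0
    have hcard : d + 1 + f ≤ Fintype.card V := by
      have hdisj : Disjoint ((Finset.range (d + 1)).image w) ((Finset.range f).image z) := by
        rw [Finset.disjoint_left]
        intro v hv hv'
        obtain ⟨a, ha, rfl⟩ := Finset.mem_image.1 hv
        obtain ⟨b, hb, hab⟩ := Finset.mem_image.1 hv'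
        rw [Finset.mem_range] at ha hb
        exact hzC b hb ⟨a, by omega, hab.symm⟩
      have := Finset.card_le_univ (((Finset.range (d + 1)).image w) ∪ ((Finset.range f).image z))
      rwa [Finset.card_union_of_disjoint hdisj, Finset.card_image_of_injOn,
        Finset.card_image_of_injOn, Finset.card_range, Finset.card_range] at this
      · intro a ha b hb
        simp only [Finset.coe_range, Set.mem_Iio] at ha hb
        exact hzinj a (by omega) b (by omega)
      · intro a ha b hb
        simp only [Finset.coe_range, Set.mem_Iio] at ha hb
        exact hinj a (by omega) b (by omega)
    -- Both walks end at `w i`, where `z` first meets the closed walk through `x`. One goes around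
    -- via `x` and then follows `z`; the other follows `z`, returns to `u` along `w` and then takes
    -- `x` up to `w i`. Both have length `d + f + 2`.
    refine absurd (hmin (d + 1 + f) ⟨w d, w 0, z 0, w i, hxy, hx, hy, ?_, ?_⟩) (by omega)
    · rw [hzf]
      exact ((hasWalk_of_seq hw (Nat.zero_le d) le_rfl).trans (hasWalk_one hy)).trans
        (hasWalk_of_seq hz (Nat.zero_le f) le_rfl)
    · refine (((hasWalk_of_seq hz (Nat.zero_le f) le_rfl).trans (hzf ▸
        hasWalk_of_seq hw hi le_rfl)).trans ((hasWalk_one hx).trans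
        (hasWalk_of_seq hw (Nat.zero_le i) hi))).of_eq ?_
      omega
  have ex : ∀ u, ∃ x, OnClosedWalk R u → R u x ∧ ∃ k, HasWalk R k x u := by
    intro u
    by_cases hu : OnClosedWalk R u
    · obtain ⟨k, x, hx, h⟩ := hu
      exact ⟨x, fun _ => ⟨hx, k, h⟩⟩
    · exact ⟨u, fun h => absurd h hu⟩
  choose σ hσ using ex
  refine ⟨σ, fun h => (hσ _ h).1, fun h => (hσ _ h).2, fun {u x k} hx h => ?_⟩
  have hu : OnClosedWalk R u := ⟨k, x, hx, h⟩
  exact key u _ _ hx (hσ u hu).1 ⟨k, h⟩ (hσ u hu).2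

namespace IsCycleSucc

variable {σ : V → V}

theorem eq_iterate (h : IsCycleSucc R σ) {k m : ℕ} {u v : V} (h₁ : HasWalk R k u v)
    (h₂ : HasWalk R m v u) : v = σ^[k] u := by
  induction k generalizing u m with
  | zero => exact Eq.symm h₁
  | succ k ih =>
    obtain ⟨x, hx, h₁⟩ := h₁
    rw [iterate_succ_apply, ← h.unique hx (h₁.trans h₂)]
    exact ih h₁ (h₂.trans (hasWalk_one hx))

theorem cyclic_iterate (h : IsCycleSucc R σ) {u : V} (hu : OnClosedWalk R u) (k : ℕ) :
    OnClosedWalk R (σ^[k] u) := by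
  induction k with
  | zero => exact hu
  | succ k ih =>
    rw [iterate_succ_apply']
    obtain ⟨m, hm⟩ := h.back ih
    exact ⟨m, hm.trans (hasWalk_one (h.step ih))⟩

theorem hasWalk_iterate (h : IsCycleSucc R σ) {u : V} (hu : OnClosedWalk R u) (k : ℕ) :
    HasWalk R k u (σ^[k] u) := by
  induction k with
  | zero => rfl
  | succ k ih =>
    rw [iterate_succ_apply']
    exact ih.trans (hasWalk_one (h.step (h.cyclic_iterate hu k)))

theorem iterate_back (h : IsCycleSucc R σ) {u : V} (hu : OnClosedWalk R u) (k : ℕ) :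
    ∃ m, HasWalk R m (σ^[k] u) u := by
  induction k with
  | zero => exact ⟨0, rfl⟩
  | succ k ih =>
    rw [iterate_succ_apply']
    obtain ⟨m, hm⟩ := h.back (h.cyclic_iterate hu k)
    obtain ⟨l, hl⟩ := ih
    exact ⟨_, hm.trans hl⟩

theorem period_pos (h : IsCycleSucc R σ) {u : V} (hu : OnClosedWalk R u) :
    0 < minimalPeriod σ u := by
  obtain ⟨k, hk⟩ := hu
  exact IsPeriodicPt.minimalPeriod_pos k.succ_pos (h.eq_iterate (m := 0) hk rfl).symm

theorem mem_periodicPts (h : IsCycleSucc R σ) {u : V} (hu : OnClosedWalk R u) :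
    u ∈ periodicPts σ := minimalPeriod_pos_iff_mem_periodicPts.1 (h.period_pos hu)

end IsCycleSucc

theorem iterate_add_of_dvd {σ : V → V} {u : V} {d : ℕ} (hd : minimalPeriod σ u ∣ d) (k : ℕ) :
    σ^[k + d] u = σ^[k] u := by
  rw [iterate_add_apply, isPeriodicPt_iff_minimalPeriod_dvd.2 hd]

/-- The vertices of the cycle through `u`. -/
noncomputable def cycleFinset [DecidableEq V] (σ : V → V) (u : V) : Finset V :=
  (Finset.range (minimalPeriod σ u)).image (σ^[·] u)

theorem card_cycleFinset [DecidableEq V] (σ : V → V) (u : V) :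
    (cycleFinset σ u).card = minimalPeriod σ u := by
  rw [cycleFinset, Finset.card_image_of_injOn, Finset.card_range]
  rw [Finset.coe_range]
  exact iterate_injOn_Iio_minimalPeriod

/-- A repeated vertex lies on a closed walk, so the vertices before the first cyclic time `s` and
after the last cyclic time `e` are distinct. Under `hT` the ends of the segment from `s` to `e`
reach each other; the segment therefore follows one cycle, and whole turns can be cut out of it. -/
theorem IsCycleSucc.exists_excursion [Fintype V] {σ : V → V} (h : IsCycleSucc R σ)
    (hT : ∀ {u v k}, OnClosedWalk R u → OnClosedWalk R v → HasWalk R k u v → ∃ m, HasWalk R m v u)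
    {w : ℕ → V} {N : ℕ} (hN : Fintype.card V ≤ N) (hw : ∀ i < N, R (w i) (w (i + 1))) :
    ∃ s e, s ≤ e ∧ e ≤ N ∧ OnClosedWalk R (w s) ∧ (∀ i ≤ N, OnClosedWalk R (w i) → s ≤ i) ∧
      (s = 0 → 1 ≤ e → w 1 = σ (w 0)) ∧
      (∃ O : Finset V, (∀ x ∈ O, ¬ OnClosedWalk R x) ∧ O.card = s + (N - e)) ∧
      ∀ d, minimalPeriod σ (w s) ∣ d → d ≤ e - s → HasWalk R (e - s - d) (w s) (w e) := by
  classical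
  have rep : ∀ i j, i < j → j ≤ N → w i = w j → OnClosedWalk R (w i) := by
    intro i j hij hj he
    have := hasWalk_of_seq hw hij.le hj
    rw [← he] at this
    exact ⟨j - i - 1, this.of_eq (by omega)⟩
  have inj : ∀ i ≤ N, ∀ j ≤ N, ¬ OnClosedWalk R (w i) → ¬ OnClosedWalk R (w j) → w i = w j →
      i = j := by
    intro i hi j hj hci hcj he
    rcases lt_trichotomy i j with hij | hij | hij
    · exact absurd (rep i j hij hj he) hci
    · exact hij
    · exact absurd (rep j i hij hi he.symm) hcj
  have ex : ∃ i, i ≤ N ∧ OnClosedWalk R (w i) := by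
    by_contra hno
    push Not at hno
    have := Finset.card_le_univ ((Finset.range (N + 1)).image w)
    rw [Finset.card_image_of_injOn, Finset.card_range] at this
    · omega
    · intro i hi j hj he
      simp only [Finset.coe_range, Set.mem_Iio] at hi hj
      exact inj i (by omega) j (by omega) (hno i (by omega)) (hno j (by omega)) he
  obtain ⟨s, ⟨hsN, hs⟩, hsmin⟩ : ∃ s, (s ≤ N ∧ OnClosedWalk R (w s)) ∧
      ∀ i ≤ N, OnClosedWalk R (w i) → s ≤ i :=
    ⟨Nat.find ex, Nat.find_spec ex, fun i hi hc => Nat.find_min' ex ⟨hi, hc⟩⟩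
  obtain ⟨e, ⟨heN, he⟩, hemax⟩ : ∃ e, (e ≤ N ∧ OnClosedWalk R (w e)) ∧
      ∀ i ≤ N, OnClosedWalk R (w i) → i ≤ e := by
    refine ⟨Nat.findGreatest (fun i => OnClosedWalk R (w i)) N, ⟨Nat.findGreatest_le N,
      Nat.findGreatest_spec (P := fun i => OnClosedWalk R (w i)) hsN hs⟩,
      fun i hi hc => Nat.le_findGreatest hi hc⟩
  have hse := hsmin e heN he
  have hwalk := hasWalk_of_seq hw hse heN
  obtain ⟨m, hm⟩ := hT hs he hwalk
  refine ⟨s, e, hse, heN, hs, hsmin, ?_, ?_, ?_⟩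
  · rintro rfl he1
    exact h.unique (hw 0 (by omega)) ((hasWalk_of_seq hw he1 heN).trans hm)
  · have out : ∀ i ∈ Finset.range s ∪ Finset.Ioc e N, i ≤ N ∧ ¬ OnClosedWalk R (w i) := by
      intro i hi
      rw [Finset.mem_union, Finset.mem_range, Finset.mem_Ioc] at hi
      refine ⟨by omega, fun hc => ?_⟩
      have h1 := hsmin i (by omega) hc
      have h2 := hemax i (by omega) hc
      omega
    refine ⟨(Finset.range s ∪ Finset.Ioc e N).image w, ?_, ?_⟩
    · intro x hx
      obtain ⟨i, hi, rfl⟩ := Finset.mem_image.1 hx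
      exact (out i hi).2
    · rw [Finset.card_image_of_injOn, Finset.card_union_of_disjoint, Finset.card_range,
        Nat.card_Ioc]
      · rw [Finset.disjoint_left]
        intro i hi hi'
        rw [Finset.mem_range] at hi
        rw [Finset.mem_Ioc] at hi'
        omega
      · intro i hi j hj hij
        exact inj i (out i hi).1 j (out j hj).1 (out i hi).2 (out j hj).2 hij
  · intro d hd hde
    have h1 := h.eq_iterate hwalk hm
    rw [show e - s = e - s - d + d by omega, iterate_add_of_dvd hd] at h1
    rw [h1]
    exact h.hasWalk_iterate hs _

theorem HasWalk.exists_seq_cons {k : ℕ} {u x v : V} (hx : R u x) (h : HasWalk R k x v) :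
    ∃ w : ℕ → V, w 0 = u ∧ w 1 = x ∧ w (k + 1) = v ∧ ∀ i < k + 1, R (w i) (w (i + 1)) := by
  obtain ⟨w, h0, hk, hw⟩ := h.exists_seq
  refine ⟨fun i => Nat.casesOn i u w, rfl, h0, hk, ?_⟩
  rintro (_ | i) hi
  · simpa [h0] using hx
  · exact hw i (by omega)

theorem IsCycleSucc.onClosedWalk_of_mem [DecidableEq V] {σ : V → V} (h : IsCycleSucc R σ) {u x : V}
    (hu : OnClosedWalk R u) (hx : x ∈ cycleFinset σ u) : OnClosedWalk R x := by
  obtain ⟨k, -, rfl⟩ := Finset.mem_image.1 hx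
  exact h.cyclic_iterate hu k

theorem IsCycleSucc.disjoint_cycleFinset [DecidableEq V] {σ : V → V} (h : IsCycleSucc R σ) {u v : V}
    (hu : OnClosedWalk R u) (hv : OnClosedWalk R v) (huv : ∀ k, v ≠ σ^[k] u) :
    Disjoint (cycleFinset σ u) (cycleFinset σ v) := by
  rw [Finset.disjoint_left]
  intro x hx hx'
  obtain ⟨k, -, rfl⟩ := Finset.mem_image.1 hx
  obtain ⟨l, -, hl⟩ := Finset.mem_image.1 hx'
  obtain ⟨m, hm⟩ := h.iterate_back hv l
  obtain ⟨m', hm'⟩ := h.iterate_back hu k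
  refine huv (k + m) (h.eq_iterate (m := l + m') ((h.hasWalk_iterate hu k).trans ?_)
    ((h.hasWalk_iterate hv l).trans ?_))
  · rw [← show σ^[l] v = σ^[k] u from hl]; exact hm
  · rw [show σ^[l] v = σ^[k] u from hl]; exact hm'

/-- If no cycle leads to another one, then long walks that form a diamond can be shortened. -/
theorem IsCycleSucc.exists_lt_lcm [Fintype V] {σ : V → V} (h : IsCycleSucc R σ)
    (hT : ∀ {u v k}, OnClosedWalk R u → OnClosedWalk R v → HasWalk R k u v → ∃ m, HasWalk R m v u)
    {t : ℕ} (ht : HasDiamond R t) (hmin : ∀ m, HasDiamond R m → t ≤ m)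
    (hcard : Fintype.card V ≤ t) :
    ∃ p q, 1 ≤ p ∧ 1 ≤ q ∧ p + q ≤ Fintype.card V ∧
      t + p + q + 2 ≤ Fintype.card V + p.lcm q := by
  classical
  obtain ⟨u, x, y, v, hxy, hx, hy, h₁, h₂⟩ := ht
  obtain ⟨w, h0, rfl, hv, hw⟩ := h₁.exists_seq_cons hx
  obtain ⟨z, h0', rfl, hv', hz⟩ := h₂.exists_seq_cons hy
  obtain ⟨s, e, hse, he, hs, hsmin, hσ, ⟨O, hO, hOc⟩, hcut⟩ :=
    h.exists_excursion hT (by omega) hw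
  obtain ⟨s', e', hse', he', hs', hsmin', hσ', ⟨O', hO', hOc'⟩, hcut'⟩ :=
    h.exists_excursion hT (by omega) hz
  -- If both walks stay on their cycles for at least `M` steps, cutting `M` steps from each leaves a
  -- smaller diamond.
  have dich : ∀ M, 0 < M → minimalPeriod σ (w s) ∣ M → minimalPeriod σ (z s') ∣ M →
      e - s < M ∨ e' - s' < M := by
    intro M hM hd hd'
    by_contra! hcon
    obtain ⟨hc, hc'⟩ := hcon
    -- The cut must keep both first steps. If `u` itself were cyclic, both first steps would be `σ
    -- u`.
    have hs0 : ¬ (s = 0 ∨ s' = 0) := by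
      intro h00
      have hu : OnClosedWalk R u := by
        rcases h00 with rfl | rfl
        · rwa [h0] at hs
        · rwa [h0'] at hs'
      have := hsmin 0 (Nat.zero_le _) (by rwa [h0])
      have := hsmin' 0 (Nat.zero_le _) (by rwa [h0'])
      rw [hσ (by omega) (by omega), hσ' (by omega) (by omega), h0, h0'] at hxy
      exact hxy rfl
    have hlt := hmin (t - M) ⟨u, w 1, z 1, v, hxy, hx, hy, ?_, ?_⟩
    · omega
    · rw [← hv]
      exact (((hasWalk_of_seq hw (show 1 ≤ s by omega) (by omega)).trans (hcut M hd hc)).trans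
        (hasWalk_of_seq hw he le_rfl)).of_eq (by omega)
    · rw [← hv']
      exact (((hasWalk_of_seq hz (show 1 ≤ s' by omega) (by omega)).trans (hcut' M hd' hc')).trans
        (hasWalk_of_seq hz he' le_rfl)).of_eq (by omega)
  have hp := h.period_pos hs
  have hq := h.period_pos hs'
  have one : ∀ {O : Finset V} {c : V}, (∀ x ∈ O, ¬ OnClosedWalk R x) → OnClosedWalk R c →
      O.card + minimalPeriod σ c ≤ Fintype.card V := by
    intro O c hO hc
    rw [← card_cycleFinset σ c, ← Finset.card_union_of_disjoint]
    · exact Finset.card_le_univ _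
    · exact Finset.disjoint_left.2 fun x hx hx' => hO x hx (h.onClosedWalk_of_mem hc hx')
  by_cases hsame : ∃ k, z s' = σ^[k] (w s)
  · obtain ⟨k, hk⟩ := hsame
    have hper : minimalPeriod σ (z s') = minimalPeriod σ (w s) := by
      rw [hk, minimalPeriod_apply_iterate (h.mem_periodicPts hs)]
    have h1 := one hO hs
    have h2 := one hO' hs'
    rcases dich _ hp dvd_rfl (by rw [hper]) with hc | hc <;> omega
  · push Not at hsame
    have hdisj := h.disjoint_cycleFinset hs hs' hsame
    have two : ∀ {O : Finset V}, (∀ x ∈ O, ¬ OnClosedWalk R x) →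
        O.card + (minimalPeriod σ (w s) + minimalPeriod σ (z s')) ≤ Fintype.card V := by
      intro O hO
      rw [← card_cycleFinset σ (w s), ← card_cycleFinset σ (z s'),
        ← Finset.card_union_of_disjoint hdisj, ← Finset.card_union_of_disjoint]
      · exact Finset.card_le_univ _
      · refine Finset.disjoint_left.2 fun x hx hx' => hO x hx ?_
        rcases Finset.mem_union.1 hx' with hx' | hx'
        · exact h.onClosedWalk_of_mem hs hx'
        · exact h.onClosedWalk_of_mem hs' hx'
    refine ⟨_, _, hp, hq, ?_, ?_⟩
    · have := two hO
      omega
    · have h1 := two hO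
      have h2 := two hO'
      rcases dich _ (Nat.lcm_pos hp hq) (Nat.dvd_lcm_left _ _) (Nat.dvd_lcm_right _ _) with hc | hc <;>
        omega

end Cycles

/-! ### Maximizing `lcm(p,q) - p - q` -/

section Arithmetic

/-- Since `pq - p - q = (p - 1)(q - 1) - 1`, the substitution `P = p - 1`, `Q = q - 1` turns the
claim into exact identities whose nonnegative slack vanishes only in the extremal cases. -/
theorem coprime_bound {n p q : ℕ} (hn : 7 ≤ n) (hp : 1 ≤ p) (hpq : p ≤ q) (hc : p.Coprime q)
    (h : p + q ≤ n) :
    p * q + n ≤ gBound n + p + q ∧ (p * q + n = gBound n + p + q →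
      (p + q = n ∧ ({p, q} : Set ℕ) = extremalPair n) ∨ (n = 10 ∧ p = 4 ∧ q = 5)) := by
  obtain ⟨P, rfl⟩ := Nat.exists_eq_add_of_le' hp
  obtain ⟨Q, rfl⟩ := Nat.exists_eq_add_of_le' (hp.trans hpq)
  unfold gBound extremalPair
  by_cases h2 : n % 2 = 1
  · obtain ⟨m, rfl⟩ : ∃ m, n = 2 * m + 1 := ⟨n / 2, by omega⟩
    rw [if_pos h2, if_pos h2, show ((2 * m + 1) ^ 2 - 1) / 4 = m ^ 2 + m by
      rw [show (2 * m + 1) ^ 2 - 1 = 4 * (m ^ 2 + m) by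
        rw [show (2 * m + 1) ^ 2 = 4 * (m ^ 2 + m) + 1 by ring]; rfl]; omega,
      show (2 * m + 1 + 1) / 2 = m + 1 by omega, show (2 * m + 1 - 1) / 2 = m by omega]
    -- Here `d` measures how far `p` lies below its extremal value, and `r` below is `n - p - q`.
    -- The same parameters serve the other residues, with the extremal value of `p` changed.
    obtain ⟨d, rfl⟩ : ∃ d, m = P + 1 + d := ⟨m - 1 - P, by omega⟩
    obtain ⟨r, hr⟩ : ∃ r, Q + r = P + 1 + 2 * d := ⟨P + 1 + 2 * d - Q, by omega⟩
    have hQ : (Q : ℤ) = P + 1 + 2 * d - r := by omega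
    have key : ((P + 1 : ℕ) * (Q + 1 : ℕ) + (2 * (P + 1 + d) + 1 : ℕ) : ℤ) + d * (d + 1) + P * r =
        ((P + 1 + d) ^ 2 + (P + 1 + d) : ℕ) + (P + 1 : ℕ) + (Q + 1 : ℕ) := by
      push_cast; rw [hQ]; ring
    norm_cast at key
    refine ⟨by omega, fun he => Or.inl ?_⟩
    have h0 : d * (d + 1) + P * r = 0 := by omega
    have hd : d = 0 := by rcases Nat.eq_zero_or_pos d with h | h; exact h; nlinarith
    subst hd
    have hP : P ≠ 0 := by omega
    have hr0 : r = 0 := by simpa [hP] using h0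
    have : Q = P + 1 := by omega
    subst this
    exact ⟨by omega, Set.pair_comm _ _⟩
  · by_cases h4 : n % 4 = 0
    · obtain ⟨m, rfl⟩ : ∃ m, n = 2 * m := ⟨n / 2, by omega⟩
      rw [if_neg h2, if_neg h2, if_pos h4, if_pos h4, show ((2 * m) ^ 2 - 4) / 4 = m ^ 2 - 1 by
        rw [show (2 * m) ^ 2 = 4 * m ^ 2 by ring]; omega,
        show (2 * m + 2) / 2 = m + 1 by omega, show (2 * m - 2) / 2 = m - 1 by omega]
      have hP : P + 2 ≤ m := by
        by_contra hP
        have : P = Q := by omega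
        subst this
        rw [Nat.coprime_self] at hc
        omega
      obtain ⟨d, rfl⟩ : ∃ d, m = P + 2 + d := ⟨m - 2 - P, by omega⟩
      obtain ⟨r, hr⟩ : ∃ r, Q + r = P + 2 + 2 * d := ⟨P + 2 + 2 * d - Q, by omega⟩
      have hQ : (Q : ℤ) = P + 2 + 2 * d - r := by omega
      have key : ((P + 1 : ℕ) * (Q + 1 : ℕ) + (2 * (P + 2 + d) : ℕ) : ℤ) + d * (d + 2) + P * r + 1 =
          ((P + 2 + d) ^ 2 : ℕ) + (P + 1 : ℕ) + (Q + 1 : ℕ) := by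
        push_cast; rw [hQ]; ring
      norm_cast at key
      have hpos : 1 ≤ (P + 2 + d) ^ 2 := Nat.one_le_pow _ _ (by omega)
      refine ⟨by omega, fun he => Or.inl ?_⟩
      have h0 : d * (d + 2) + P * r = 0 := by omega
      have hd : d = 0 := by rcases Nat.eq_zero_or_pos d with h | h; exact h; nlinarith
      subst hd
      have hP : P ≠ 0 := by omega
      have hr0 : r = 0 := by simpa [hP] using h0
      have : Q = P + 2 := by omega
      subst this
      exact ⟨by omega, Set.pair_comm _ _⟩
    · obtain ⟨m, rfl⟩ : ∃ m, n = 2 * m := ⟨n / 2, by omega⟩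
      rw [if_neg h2, if_neg h2, if_neg h4, if_neg h4, show ((2 * m) ^ 2 - 16) / 4 = m ^ 2 - 4 by
        rw [show (2 * m) ^ 2 = 4 * m ^ 2 by ring]; omega,
        show (2 * m + 4) / 2 = m + 2 by omega, show (2 * m - 4) / 2 = m - 2 by omega]
      have hP : P + 2 ≤ m := by
        by_contra hP
        have : P = Q := by omega
        subst this
        rw [Nat.coprime_self] at hc
        omega
      by_cases hP3 : P + 3 ≤ m
      · obtain ⟨d, rfl⟩ : ∃ d, m = P + 3 + d := ⟨m - 3 - P, by omega⟩
        obtain ⟨r, hr⟩ : ∃ r, Q + r = P + 4 + 2 * d := ⟨P + 4 + 2 * d - Q, by omega⟩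
        have hQ : (Q : ℤ) = P + 4 + 2 * d - r := by omega
        have key : ((P + 1 : ℕ) * (Q + 1 : ℕ) + (2 * (P + 3 + d) : ℕ) : ℤ) + d * (d + 4) + P * r
            + 4 = ((P + 3 + d) ^ 2 : ℕ) + (P + 1 : ℕ) + (Q + 1 : ℕ) := by
          push_cast; rw [hQ]; ring
        norm_cast at key
        have hpos : 4 ≤ (P + 3 + d) ^ 2 := by nlinarith
        refine ⟨by omega, fun he => Or.inl ?_⟩
        have h0 : d * (d + 4) + P * r = 0 := by omega
        have hd : d = 0 := by rcases Nat.eq_zero_or_pos d with h | h; exact h; nlinarith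
        subst hd
        have hP : P ≠ 0 := by omega
        have hr0 : r = 0 := by simpa [hP] using h0
        have : Q = P + 4 := by omega
        subst this
        exact ⟨by omega, Set.pair_comm _ _⟩
      -- Now `p = n/2 - 1` is even, so the partner `q = n/2 + 1` is not coprime to it and `p + q ≤ n
      -- - 1`. The slack `d + (d + 3) r`, with `d = p - 4`, vanishes only for the exceptional pair
      -- with `n = 10`.
      · obtain rfl : m = P + 2 := by omega
        have hQ : Q ≤ P + 1 := by
          by_contra hQ
          have : Q = P + 2 := by omega
          subst this
          have h1 : 2 ∣ P + 1 := by omega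
          have h2 : 2 ∣ P + 2 + 1 := by omega
          have := Nat.dvd_gcd h1 h2
          rw [hc] at this
          omega
        obtain ⟨r, hr⟩ : ∃ r, Q + r = P + 1 := ⟨P + 1 - Q, by omega⟩
        obtain ⟨d, rfl⟩ : ∃ d, P = d + 3 := ⟨P - 3, by omega⟩
        have hQ : (Q : ℤ) = d + 4 - r := by omega
        have key : ((d + 3 + 1 : ℕ) * (Q + 1 : ℕ) + (2 * (d + 3 + 2) : ℕ) : ℤ) + d + (d + 3) * r
            + 4 = ((d + 3 + 2) ^ 2 : ℕ) + (d + 3 + 1 : ℕ) + (Q + 1 : ℕ) := by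
          push_cast; rw [hQ]; ring
        norm_cast at key
        have hpos : 4 ≤ (d + 3 + 2) ^ 2 := by nlinarith
        refine ⟨by omega, fun he => Or.inr ?_⟩
        have h0 : d + (d + 3) * r = 0 := by omega
        have hr0 : r = 0 := by
          rcases Nat.eq_zero_or_pos r with h | h; exact h; nlinarith
        omega

theorem sq_le_gBound {n : ℕ} (hn : 7 ≤ n) : n ^ 2 ≤ 4 * gBound n + 16 := by
  unfold gBound
  have h4 : n ^ 2 % 4 = (n % 4) ^ 2 % 4 := Nat.pow_mod _ _ _
  have h49 : 49 ≤ n ^ 2 := by nlinarith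
  have : n % 4 < 4 := Nat.mod_lt _ (by norm_num)
  split_ifs
  all_goals
    interval_cases hh : n % 4 <;> omega

/-- A common factor at least halves the product `pq`, which makes the inequality strict; the coprime
case is `coprime_bound` up to symmetry. -/
theorem lcm_bound {n p q : ℕ} (hn : 7 ≤ n) (hp : 1 ≤ p) (hq : 1 ≤ q) (h : p + q ≤ n) :
    p.lcm q + n ≤ gBound n + p + q ∧ (p.lcm q + n = gBound n + p + q → p.Coprime q ∧
      ((p + q = n ∧ ({p, q} : Set ℕ) = extremalPair n) ∨
        (n = 10 ∧ (p = 4 ∧ q = 5 ∨ p = 5 ∧ q = 4)))) := by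
  by_cases hc : p.Coprime q
  · rw [hc.lcm_eq_mul]
    rcases le_total p q with hpq | hpq
    · obtain ⟨h1, h2⟩ := coprime_bound hn hp hpq hc h
      refine ⟨h1, fun he => ⟨hc, ?_⟩⟩
      rcases h2 he with h2 | ⟨h2, h3⟩
      · exact Or.inl h2
      · exact Or.inr ⟨h2, Or.inl h3⟩
    · obtain ⟨h1, h2⟩ := coprime_bound hn hq hpq hc.symm (by omega)
      rw [mul_comm] at h1 h2
      refine ⟨by omega, fun he => ⟨hc, ?_⟩⟩
      rcases h2 (by omega) with h2 | ⟨h2, h3⟩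
      · exact Or.inl ⟨by omega, by rw [Set.pair_comm]; exact h2.2⟩
      · exact Or.inr ⟨h2, Or.inr h3.symm⟩
  · have hlt : p.lcm q + n < gBound n + p + q := by
      have hg : 2 ≤ p.gcd q := by
        have := Nat.gcd_pos_of_pos_left q hp
        have : p.gcd q ≠ 1 := hc
        omega
      have hmul := Nat.gcd_mul_lcm p q
      have h2 : 2 * p.lcm q ≤ p * q := by rw [← hmul]; exact Nat.mul_le_mul_right _ hg
      have hp2 : 2 ≤ p := hg.trans (Nat.gcd_le_left _ hp)
      have hq2 : 2 ≤ q := hg.trans (Nat.gcd_le_right _ hq)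
      have hb := sq_le_gBound hn
      zify at *
      -- With `S = p + q`, the hints give `pq/2 - S ≤ S²/8 - S ≤ n²/8 - n`, and `n²/8 < (n² - 16)/4`
      -- for `n ≥ 7`.
      nlinarith [sq_nonneg ((p : ℤ) - q), mul_nonneg (show (0 : ℤ) ≤ n - p - q by linarith)
        (show (0 : ℤ) ≤ n + p + q - 8 by linarith)]
    exact ⟨hlt.le, fun he => absurd he hlt.ne⟩

end Arithmetic

/-! ### Two cycles joined by a path -/

section Bridges

variable {V : Type*} {R : V → V → Prop} {σ : V → V} {a b : V} {l : ℕ} {w : ℕ → V}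

/-- `w` is a walk of length `l` from `a` to `b`, vertices on two different cycles, which meets
these cycles only at its ends. -/
structure IsBridge (R : V → V → Prop) (σ : V → V) (a b : V) (l : ℕ) (w : ℕ → V) : Prop where
  source : OnClosedWalk R a
  target : OnClosedWalk R b
  no_return : ∀ k, ¬ HasWalk R k b a
  start : w 0 = a
  finish : w l = b
  walk : ∀ i < l, R (w i) (w (i + 1))
  inj : ∀ i ≤ l, ∀ j ≤ l, w i = w j → i = j
  left : ∀ i ≤ l, 0 < i → ∀ k, w i ≠ σ^[k] a
  right : ∀ i < l, ∀ k, w i ≠ σ^[k] b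

/-- A shortest walk between the two cycles, taken as vertex sets, has all the required properties.
-/
theorem IsCycleSucc.exists_isBridge (h : IsCycleSucc R σ) {u v : V} (hu : OnClosedWalk R u)
    (hv : OnClosedWalk R v) (huv : ∃ k, HasWalk R k u v) (hvu : ∀ k, ¬ HasWalk R k v u) :
    ∃ a b l w, IsBridge R σ a b l w := by
  obtain ⟨k, hk⟩ := huv
  obtain ⟨l, w, ⟨i, hi⟩, ⟨j, hj⟩, hw, hinj, hS, hT⟩ :=
    exists_geodesic (R := R) (S := Set.range fun i => σ^[i] u) (T := Set.range fun i => σ^[i] v)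
      ⟨k, u, ⟨0, rfl⟩, v, ⟨0, rfl⟩, hk⟩
  refine ⟨w 0, w l, l, w, ?_, ?_, ?_, rfl, rfl, hw, hinj, ?_, ?_⟩
  · exact hi ▸ h.cyclic_iterate hu i
  · exact hj ▸ h.cyclic_iterate hv j
  · intro m hm
    obtain ⟨m', hm'⟩ := h.iterate_back hu i
    rw [show σ^[i] u = w 0 from hi] at hm'
    have := h.hasWalk_iterate hv j
    rw [show σ^[j] v = w l from hj] at this
    exact hvu _ ((this.trans hm).trans hm')
  · intro m hm h0 c hc
    refine hS m hm h0 ⟨c + i, ?_⟩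
    simp only
    rw [iterate_add_apply, show σ^[i] u = w 0 from hi, hc]
  · intro m hm c hc
    refine hT m hm ⟨c + j, ?_⟩
    simp only
    rw [iterate_add_apply, show σ^[j] v = w l from hj, hc]

theorem IsCycleSucc.adj_iterate_iff (h : IsCycleSucc R σ) {u : V} (hu : OnClosedWalk R u) {i j : ℕ}
    (hj : j < minimalPeriod σ u) :
    R (σ^[i] u) (σ^[j] u) ↔ j = (i + 1) % minimalPeriod σ u := by
  have hmod := Nat.mod_lt (i + 1) (h.period_pos hu)
  rw [← iterate_eq_iterate_iff_of_lt_minimalPeriod hj hmod, iterate_mod_minimalPeriod_eq,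
    iterate_succ_apply']
  constructor
  · intro hR
    obtain ⟨m, hm⟩ := h.iterate_back hu j
    exact h.unique hR (hm.trans (h.hasWalk_iterate hu i))
  · intro he
    rw [he]
    exact h.step (h.cyclic_iterate hu i)

namespace IsBridge

theorem pos (B : IsBridge R σ a b l w) : 1 ≤ l := by
  rcases Nat.eq_zero_or_pos l with rfl | hl
  · exact absurd (show HasWalk R 0 b a from B.finish.symm.trans B.start) (B.no_return 0)
  · exact hl

theorem hasWalk_left (B : IsBridge R σ a b l w) {i : ℕ} (hi : i ≤ l) : HasWalk R i a (w i) := by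
  have := hasWalk_of_seq B.walk (Nat.zero_le i) hi
  rwa [B.start] at this

theorem hasWalk_right (B : IsBridge R σ a b l w) {i : ℕ} (hi : i ≤ l) :
    HasWalk R (l - i) (w i) b := by
  have := hasWalk_of_seq B.walk hi le_rfl
  rwa [B.finish] at this

theorem adj_one (B : IsBridge R σ a b l w) : R a (w 1) := by
  have := B.walk 0 B.pos
  rwa [B.start] at this

theorem succ_ne (B : IsBridge R σ a b l w) : σ a ≠ w 1 :=
  fun he => B.left 1 B.pos one_pos 1 he.symm

theorem hasWalk_cycle_pred (h : IsCycleSucc R σ) (B : IsBridge R σ a b l w) {d r : ℕ} (hd : 0 < d)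
    (hr : σ^[d] a = σ^[r] a) : HasWalk R (d - 1) (σ a) (σ^[r] a) := by
  have := h.hasWalk_iterate (h.cyclic_iterate B.source 1) (d - 1)
  rwa [← iterate_add_apply, Nat.sub_add_cancel hd, hr] at this

/-- Turning around the first cycle before the bridge, or around the second one after it. -/
theorem hasDiamond (h : IsCycleSucc R σ) (B : IsBridge R σ a b l w) {M : ℕ} (hM : 0 < M)
    (ha : minimalPeriod σ a ∣ M) (hb : minimalPeriod σ b ∣ M) : HasDiamond R (M + l - 1) := by
  have hl := B.pos
  refine ⟨a, σ a, w 1, b, B.succ_ne, h.step B.source, B.adj_one, ?_, ?_⟩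
  · have := hasWalk_cycle_pred h B hM (r := 0) (isPeriodicPt_iff_minimalPeriod_dvd.2 ha)
    have hab := B.hasWalk_left le_rfl
    rw [B.finish] at hab
    exact (HasWalk.trans (v := a) this hab).of_eq (by omega)
  · have := h.hasWalk_iterate B.target M
    rw [isPeriodicPt_iff_minimalPeriod_dvd.2 hb] at this
    exact ((B.hasWalk_right hl).trans this).of_eq (by omega)

/-- If diamonds are as long as the cycle lengths permit, then the bridge is the only walk of its
length or less between the two cycles. -/
theorem eq_of_hasWalk (h : IsCycleSucc R σ) (B : IsBridge R σ a b l w)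
    (hc : (minimalPeriod σ a).Coprime (minimalPeriod σ b))
    (hmin : ∀ m, HasDiamond R m → minimalPeriod σ a * minimalPeriod σ b + l - 1 ≤ m)
    {r s m : ℕ} {y : V} (hr : r < minimalPeriod σ a) (hs : s < minimalPeriod σ b) (hml : m + 1 ≤ l)
    (hy : R (σ^[r] a) y) (hyb : HasWalk R m y (σ^[s] b)) :
    r = 0 ∧ s = 0 ∧ m + 1 = l ∧ y = w 1 := by
  have hp := h.period_pos B.source
  have hq := h.period_pos B.target
  have hpq := Nat.mul_pos hp hq
  have hl := B.pos
  -- `K` is chosen so that `K + l - (m + 1)` steps around the first cycle before the new route, and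
  -- `K` steps around the second one after the bridge, give walks of the same length `K + l` to
  -- `σ^[s] b`. The multiple of the period keeps the residue a natural number.
  obtain ⟨K, hKlt, hKa, hKb⟩ : ∃ K < minimalPeriod σ a * minimalPeriod σ b,
      K ≡ r + (l * minimalPeriod σ a - (l - (m + 1))) [MOD minimalPeriod σ a] ∧
      K ≡ s [MOD minimalPeriod σ b] :=
    ⟨_, Nat.chineseRemainder_lt_mul hc _ _ hp.ne' hq.ne', (Nat.chineseRemainder hc _ _).2⟩
  have hJ : K + (l - (m + 1)) ≡ r [MOD minimalPeriod σ a] := by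
    refine (hKa.add_right _).trans ?_
    have : l ≤ l * minimalPeriod σ a := Nat.le_mul_of_pos_right _ hp
    rw [add_assoc, Nat.sub_add_cancel (by omega)]
    exact (Nat.modEq_zero_iff_dvd.2 (Dvd.intro_left l rfl)).add_left r
  have hJa : σ^[K + (l - (m + 1))] a = σ^[r] a := by
    rw [← iterate_mod_minimalPeriod_eq, hJ, iterate_mod_minimalPeriod_eq]
  have hKb' : σ^[K] b = σ^[s] b := by
    rw [← iterate_mod_minimalPeriod_eq, hKb, iterate_mod_minimalPeriod_eq]
  have h1 : HasWalk R (l - 1 + K) (w 1) (σ^[s] b) :=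
    (B.hasWalk_right hl).trans (hKb' ▸ h.hasWalk_iterate B.target K)
  -- Some turning before the new route makes the first steps `σ a` and `w 1` differ, a diamond that
  -- is too small as `K < pq`. Without turning, the new route must itself start along the bridge.
  rcases Nat.eq_zero_or_pos (K + (l - (m + 1))) with h0 | hJpos
  · have hr0 : r = 0 := by
      rw [h0] at hJ
      have : 0 % _ = r % _ := hJ
      rwa [Nat.zero_mod, Nat.mod_eq_of_lt hr, eq_comm] at this
    obtain rfl : K = 0 := by omega
    have hs0 : s = 0 := by
      have : 0 % _ = s % _ := hKb
      rwa [Nat.zero_mod, Nat.mod_eq_of_lt hs, eq_comm] at this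
    refine ⟨hr0, hs0, by omega, ?_⟩
    by_contra hne
    rw [hr0] at hy
    have := hmin (l - 1) ⟨a, y, w 1, σ^[s] b, hne, hy, B.adj_one, hyb.of_eq (by omega), h1⟩
    omega
  · have h2 := ((hasWalk_cycle_pred h B hJpos hJa).trans (hasWalk_one hy)).trans hyb
    have := hmin (l - 1 + K) ⟨a, σ a, w 1, _, B.succ_ne, h.step B.source, B.adj_one,
      h2.of_eq (by omega), h1⟩
    omega

end IsBridge

/-- The vertices of two cycles and a bridge between them. -/
def bridgeMap (σ : V → V) (a b : V) (l : ℕ) (w : ℕ → V) :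
    Fin (minimalPeriod σ a) ⊕ Fin (l + 1 - 2) ⊕ Fin (minimalPeriod σ b) → V
  | .inl i => σ^[i] a
  | .inr (.inl s) => w (s + 1)
  | .inr (.inr j) => σ^[j] b

namespace IsBridge

theorem iterate_ne_iterate (h : IsCycleSucc R σ) (B : IsBridge R σ a b l w) (i j : ℕ) :
    σ^[i] a ≠ σ^[j] b := by
  intro he
  obtain ⟨m, hm⟩ := h.iterate_back B.source i
  have := h.hasWalk_iterate B.target j
  rw [← he] at this
  exact B.no_return _ (this.trans hm)

theorem injective_bridgeMap (h : IsCycleSucc R σ) (B : IsBridge R σ a b l w) :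
    Injective (bridgeMap σ a b l w) := by
  have hl := B.pos
  have cyc : ∀ (c : V) (i j : Fin (minimalPeriod σ c)), σ^[i] c = σ^[j] c → i = j :=
    fun c i j hij => Fin.ext ((iterate_eq_iterate_iff_of_lt_minimalPeriod i.2 j.2).1 hij)
  rintro (i | s | j) (i' | s' | j') he
  · rw [cyc a i i' he]
  · exact absurd (Eq.symm he) (B.left _ (by omega) (Nat.succ_pos _) i)
  · exact absurd he (B.iterate_ne_iterate h i j')
  · exact absurd he (B.left _ (by omega) (Nat.succ_pos _) i')
  · have : s.val + 1 = s'.val + 1 := B.inj _ (by omega) _ (by omega) he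
    rw [Fin.ext (Nat.succ_injective this)]
  · exact absurd he (B.right _ (by omega) j')
  · exact absurd (Eq.symm he) (B.iterate_ne_iterate h i' j)
  · exact absurd (Eq.symm he) (B.right _ (by omega) j)
  · rw [cyc b j j' he]

theorem card_le [Fintype V] (h : IsCycleSucc R σ) (B : IsBridge R σ a b l w) :
    minimalPeriod σ a + minimalPeriod σ b + l ≤ Fintype.card V + 1 := by
  have := Fintype.card_le_of_injective _ (B.injective_bridgeMap h)
  rw [Fintype.card_sum, Fintype.card_sum, Fintype.card_fin, Fintype.card_fin, Fintype.card_fin]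
    at this
  have := B.pos
  omega

/-- By `hcard` the cycles and the bridge exhaust the vertices, and `eq_of_hasWalk` and the absence
of return walks exclude extra arcs. As `l ≤ 2`, at most one interior vertex exists, so only a loop
there needs separate care. -/
theorem isGlasses [Fintype V] {D : Digraph V} (h : IsCycleSucc D.Adj σ)
    (B : IsBridge D.Adj σ a b l w) (hl2 : l ≤ 2)
    (hc : (minimalPeriod σ a).Coprime (minimalPeriod σ b))
    (hmin : ∀ m, HasDiamond D.Adj m → minimalPeriod σ a * minimalPeriod σ b + l - 1 ≤ m)
    (hcard : minimalPeriod σ a + minimalPeriod σ b + l = Fintype.card V + 1) :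
    IsGlasses D (minimalPeriod σ a) (l + 1) (minimalPeriod σ b) := by
  have hp := h.period_pos B.source
  have hq := h.period_pos B.target
  have hl := B.pos
  refine ⟨⟨0, hp⟩, ⟨0, hq⟩, ?_⟩
  have hbij : Bijective (bridgeMap σ a b l w) := by
    rw [Fintype.bijective_iff_injective_and_card]
    refine ⟨B.injective_bridgeMap h, ?_⟩
    rw [Fintype.card_sum, Fintype.card_sum, Fintype.card_fin, Fintype.card_fin, Fintype.card_fin]
    omega
  refine ⟨RelIso.symm ⟨Equiv.ofBijective _ hbij, fun {x y} => ?_⟩⟩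
  change D.Adj (bridgeMap σ a b l w x) (bridgeMap σ a b l w y) ↔ _
  rcases x with i | s | i <;> rcases y with j | t | j
  · exact h.adj_iterate_iff B.source j.2
  · change D.Adj (σ^[i] a) (w (t + 1)) ↔ i = ⟨0, hp⟩ ∧ t.val = 0
    constructor
    · intro hR
      obtain ⟨hi, -, ht, -⟩ := B.eq_of_hasWalk h hc hmin i.2 hq (by omega) hR
        (B.hasWalk_right (show t + 1 ≤ l by omega))
      exact ⟨Fin.ext hi, by omega⟩
    · rintro ⟨rfl, ht⟩
      rw [ht]
      exact B.adj_one
  · change D.Adj (σ^[i] a) (σ^[j] b) ↔ l + 1 = 2 ∧ i = ⟨0, hp⟩ ∧ j = ⟨0, hq⟩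
    constructor
    · intro hR
      obtain ⟨hi, hj, h1, -⟩ := B.eq_of_hasWalk h hc hmin i.2 j.2 (m := 0) (by omega) hR rfl
      exact ⟨by omega, Fin.ext hi, Fin.ext hj⟩
    · rintro ⟨h1, rfl, rfl⟩
      obtain rfl : l = 1 := by omega
      have := B.adj_one
      rwa [B.finish] at this
  · refine iff_of_false (fun hR => ?_) id
    change D.Adj (w (s + 1)) (σ^[j] a) at hR
    obtain ⟨m, hm⟩ := h.iterate_back B.source j
    exact B.left (s + 1) (by omega) (Nat.succ_pos _) _
      (h.eq_iterate (B.hasWalk_left (by omega)) ((hasWalk_one hR).trans hm))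
  · refine iff_of_false (fun hR => ?_) (fun ht => ?_)
    · change D.Adj (w (s + 1)) (w (t + 1)) at hR
      rw [show s.val = 0 by omega, show t.val = 0 by omega] at hR
      -- A loop at the interior vertex allows waiting there while the other walk turns once around
      -- the first cycle: a diamond with parameter only `p`.
      have loops : ∀ k, HasWalk D.Adj k (w 1) (w 1) := by
        intro k
        induction k with
        | zero => rfl
        | succ k ih => exact ⟨_, hR, ih⟩
      have := hmin (minimalPeriod σ a) ⟨a, σ a, w 1, w 1, B.succ_ne, h.step B.source, B.adj_one,
        (HasWalk.trans (v := a) (hasWalk_cycle_pred h B hp (r := 0) iterate_minimalPeriod)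
          (hasWalk_one B.adj_one)).of_eq (by omega), loops _⟩
      have := Nat.le_mul_of_pos_right (minimalPeriod σ a) hq
      have := Nat.mul_pos hp hq
      have := s.2
      omega
    · have ht : t.val = s.val + 1 := ht
      omega
  · change D.Adj (w (s + 1)) (σ^[j] b) ↔ s.val + 1 = l + 1 - 2 ∧ j = ⟨0, hq⟩
    have hs : s.val = 0 := by omega
    rw [hs]
    constructor
    · intro hR
      obtain ⟨-, hj, h1, -⟩ := B.eq_of_hasWalk h hc hmin hp j.2 (m := 1) (by omega) B.adj_one
        (hasWalk_one hR)
      exact ⟨by omega, Fin.ext hj⟩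
    · rintro ⟨h1, rfl⟩
      have := B.walk 1 (by omega)
      rwa [show 1 + 1 = l by omega, B.finish] at this
  · refine iff_of_false (fun hR => ?_) id
    change D.Adj (σ^[i] b) (σ^[j] a) at hR
    obtain ⟨m, hm⟩ := h.iterate_back B.source j
    exact B.no_return _ (((h.hasWalk_iterate B.target i).trans (hasWalk_one hR)).trans hm)
  · refine iff_of_false (fun hR => ?_) id
    change D.Adj (σ^[i] b) (w (t + 1)) at hR
    exact B.right (t + 1) (by omega) _ (h.eq_iterate
      ((h.hasWalk_iterate B.target i).trans (hasWalk_one hR)) (B.hasWalk_right (by omega)))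
  · exact h.adj_iterate_iff B.target j.2

end IsBridge

end Bridges

/-! ### The extremal bound and the theorem -/

theorem lt_gBound {n : ℕ} (hn : 7 ≤ n) : n < gBound n := by
  have hb := sq_le_gBound hn
  nlinarith

theorem extremalPair_spec {n p q : ℕ} (hn : 7 ≤ n) (h : ({p, q} : Set ℕ) = extremalPair n) :
    p.Coprime q ∧ p * q = gBound n := by
  have key : ∀ x y : ℕ, x.Coprime y → x * y = gBound n → ({p, q} : Set ℕ) = {y, x} →
      p.Coprime q ∧ p * q = gBound n := by
    intro x y hc hxy he
    rcases Set.pair_eq_pair_iff.1 he with ⟨rfl, rfl⟩ | ⟨rfl, rfl⟩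
    · exact ⟨hc.symm, by rw [mul_comm]; exact hxy⟩
    · exact ⟨hc, hxy⟩
  unfold extremalPair at h
  unfold gBound at key ⊢
  split_ifs at h key ⊢ with h2 h4
  · obtain ⟨m, rfl⟩ : ∃ m, n = 2 * m + 1 := ⟨n / 2, by omega⟩
    rw [show (2 * m + 1 + 1) / 2 = m + 1 by omega, show (2 * m + 1 - 1) / 2 = m by omega] at h
    refine key m (m + 1) (by simp) ?_ h
    rw [show (2 * m + 1) ^ 2 = 4 * (m * (m + 1)) + 1 by ring]
    omega
  · obtain ⟨m, rfl⟩ : ∃ m, n = 2 * m + 2 := ⟨n / 2 - 1, by omega⟩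
    rw [show (2 * m + 2 + 2) / 2 = m + 2 by omega, show (2 * m + 2 - 2) / 2 = m by omega] at h
    refine key m (m + 2) ?_ ?_ h
    · rw [Nat.coprime_self_add_right, Nat.coprime_two_right, Nat.odd_iff]
      omega
    · rw [show (2 * m + 2) ^ 2 = 4 * (m * (m + 2)) + 4 by ring]
      omega
  · obtain ⟨m, rfl⟩ : ∃ m, n = 2 * m + 4 := ⟨n / 2 - 2, by omega⟩
    rw [show (2 * m + 4 + 4) / 2 = m + 4 by omega, show (2 * m + 4 - 4) / 2 = m by omega] at h
    refine key m (m + 4) ?_ ?_ h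
    · rw [Nat.coprime_self_add_right, show 4 = 2 ^ 2 by rfl]
      refine Nat.Coprime.pow_right 2 ?_
      rw [Nat.coprime_two_right, Nat.odd_iff]
      omega
    · rw [show (2 * m + 4) ^ 2 = 4 * (m * (m + 4)) + 16 by ring]
      omega

theorem IsGlasses.le_of_hasDiamond {V : Type*} {D : Digraph V} {p k q t : ℕ}
    (h : IsGlasses D p k q) (hk : 2 ≤ k) (hpq : p.Coprime q) (ht : HasDiamond D.Adj t) :
    p * q + k - 2 ≤ t := by
  obtain ⟨a, b, ⟨f⟩⟩ := h
  exact le_of_hasDiamond_glassesAt hk hpq (ht.map f)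

/-- The least length parameter of a diamond is at most `gBound n`, with equality only for the
extremal glasses digraphs. -/
theorem hasDiamond_extremal {V : Type*} [Fintype V] {D : Digraph V} {t n : ℕ}
    (hV : Fintype.card V = n) (hn : 7 ≤ n) (ht : HasDiamond D.Adj t)
    (hmin : ∀ m, HasDiamond D.Adj m → t ≤ m) :
    t ≤ gBound n ∧ (t = gBound n → ∃ p k q, IsGlasses D p k q ∧
      ((k = 2 ∧ ({p, q} : Set ℕ) = extremalPair n) ∨
        (n = 10 ∧ k = 3 ∧ (p = 4 ∧ q = 5 ∨ p = 5 ∧ q = 4)))) := by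
  have hg := lt_gBound hn
  rcases Nat.lt_or_ge n t with htn | htn
  · obtain ⟨σ, h⟩ := exists_isCycleSucc (R := D.Adj) fun m hm => by
      have := hmin m hm
      omega
    by_cases hT : ∃ u v, OnClosedWalk D.Adj u ∧ OnClosedWalk D.Adj v ∧
        (∃ k, HasWalk D.Adj k u v) ∧ ∀ k, ¬ HasWalk D.Adj k v u
    · obtain ⟨u, v, hu, hv, huv, hvu⟩ := hT
      obtain ⟨a, b, l, w, B⟩ := h.exists_isBridge hu hv huv hvu
      have hp := h.period_pos B.source
      have hq := h.period_pos B.target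
      have hl := B.pos
      have hcard := B.card_le h
      have hle := hmin _ (B.hasDiamond h (Nat.lcm_pos hp hq) (Nat.dvd_lcm_left _ _)
        (Nat.dvd_lcm_right _ _))
      obtain ⟨h1, h2⟩ := lcm_bound hn hp hq (by omega)
      refine ⟨by omega, fun he => ?_⟩
      obtain ⟨hc, h3⟩ := h2 (by omega)
      rw [hc.lcm_eq_mul] at h1 hle
      -- Equality throughout forces `p + q + l = n + 1`, so `l = 1` when `p + q = n` and `l = 2` for
      -- the exceptional pair.
      refine ⟨_, l + 1, _, B.isGlasses h ?_ hc (fun m hm => ?_) (by omega), ?_⟩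
      · omega
      · have := hmin m hm
        omega
      · rcases h3 with ⟨h3, h4⟩ | ⟨h3, h4⟩
        · exact Or.inl ⟨by omega, h4⟩
        · exact Or.inr ⟨h3, by omega, h4⟩
    · push Not at hT
      obtain ⟨p, q, hp, hq, hpq, hle⟩ := h.exists_lt_lcm
        (fun hu hv hk => hT _ _ hu hv ⟨_, hk⟩) ht hmin (by omega)
      -- The summand 2 in `hle` keeps `t` strictly below the bound, so equality never occurs here.
      have := (lcm_bound hn hp hq (by omega)).1
      exact ⟨by omega, fun he => by omega⟩
  · exact ⟨by omega, fun he => by omega⟩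

theorem theorem1 (n : ℕ) (hn : 7 ≤ n) (A : Matrix (Fin n) (Fin n) ℕ) (hA : IsZeroOne A)
    (hfin : stableIndex A < ⊤) :
    stableIndex A ≤ (gBound n : ℕ∞) ∧
      (stableIndex A = (gBound n : ℕ∞) ↔
        (n ≠ 10 ∧ ∃ p q : ℕ, ({p, q} : Set ℕ) = extremalPair n ∧
            IsGlasses (matrixDigraph A) p 2 q) ∨
        (n = 10 ∧
          (IsGlasses (matrixDigraph A) 3 2 7 ∨ IsGlasses (matrixDigraph A) 7 2 3 ∨
            IsGlasses (matrixDigraph A) 4 3 5 ∨ IsGlasses (matrixDigraph A) 5 3 4))) := by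
  obtain ⟨t, hθ, ht, hmin⟩ := exists_stableIndex_eq hA hfin
  obtain ⟨hle, heq⟩ := hasDiamond_extremal (Fintype.card_fin n) hn ht
    fun m hm => not_lt.1 fun h => hmin m h hm
  rw [hθ, Nat.cast_le, Nat.cast_inj]
  refine ⟨hle, fun he => ?_, fun h => le_antisymm hle ?_⟩
  · obtain ⟨p, k, q, hG, ⟨rfl, hpq⟩ | ⟨rfl, rfl, ⟨rfl, rfl⟩ | ⟨rfl, rfl⟩⟩⟩ := heq he
    · by_cases h10 : n = 10
      · subst h10
        refine Or.inr ⟨rfl, ?_⟩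
        rw [show extremalPair 10 = {7, 3} by simp [extremalPair]] at hpq
        rcases Set.pair_eq_pair_iff.1 hpq with ⟨rfl, rfl⟩ | ⟨rfl, rfl⟩
        · exact Or.inr (Or.inl hG)
        · exact Or.inl hG
      · exact Or.inl ⟨h10, p, q, hpq, hG⟩
    · exact Or.inr ⟨rfl, Or.inr (Or.inr (Or.inl hG))⟩
    · exact Or.inr ⟨rfl, Or.inr (Or.inr (Or.inr hG))⟩
  · rcases h with ⟨-, p, q, hpq, hG⟩ | ⟨rfl, hG | hG | hG | hG⟩
    · obtain ⟨hc, hg⟩ := extremalPair_spec hn hpq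
      have := hG.le_of_hasDiamond le_rfl hc ht
      omega
    all_goals
      have := hG.le_of_hasDiamond (by norm_num) (by norm_num) ht
      have : gBound 10 = 21 := rfl
      omega
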